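/- Let $X\neq\{0\}$ be a real Banach space (a complex Banach space is regarded as a real one), and let $C\subset X$ be a closed convex cone with $C\cap(-C)=\{0\}$ and interior $C_0$. Write $x\le y$ if $y-x\in C$ and $x\ll y$ if $y-x\in C_0$; put $[x,y]=\{z: x\le z\le y\}$ and $(x,y)=\{z: x\ll z\ll y\}$. For $x\in X$ and $y\in C_0$ let $M(x/y)=\inf\{t\in\mathbb R: x\le ty\}$ and $m(x/y)=\sup\{t\in\mathbb R: ty\le x\}$, and for $x,y\in C_0$ let $d_T(x,y)=\ln\max\{M(x/y),M(y/x)\}$ (Thompson's part metric). Let $\varphi:C_0\to X$ be Fréchet differentiable, with derivative bounded on every closed bounded subset of $X$ contained in $C_0$. For $x\in C_0$ let $t\mapsto M_t(x)\in C_0$, $0\le t<t_{C_0}(x)\le+\infty$, be the maximal solution in $C_0$ of $\dot x(t)=\varphi(x(t))$, $x(0)=x$. For an open set $U\subset C_0$ and $x\in U$ let $t_U(x)\le t_{C_0}(x)$ be the first time at which the trajectory leaves $U$, that is, the supremum of the real $b\in(0,t_{C_0}(x))$ such that $M_t(x)\in U$ for all $t\in[0,b)$. Assume that the flow is order-preserving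 on $C_0$: if $x_1,x_2\in C_0$ and $x_1\ge x_2$, then $M_t(x_1)\ge M_t(x_2)$ for all $0\le t<\min(t_{C_0}(x_1),t_{C_0}(x_2))$. **Theorem (Convergence rate).** Let $\bar x\in C_0$ satisfy $\varphi(\bar x)=0$, let $\mu>1$, and let $U=(\mu^{-1}\bar x,\mu\bar x)$. Then the infimum $$\alpha=\inf_{\mu^{-1}<\lambda<\mu,\ \lambda\ne1} m\big((-(\lambda\ln\lambda)^{-1}\varphi(\lambda\bar x))/\bar x\big)$$ is finite, and it is the best constant, i.e. the greatest real number $\alpha$, such that $$d_T(M_t(x),\bar x)\le e^{-\alpha t}d_T(x,\bar x)\quad\text{for all }x\in U\text{ and }0\le t<t_U(x).$$ Moreover, if this $\alpha$ is non-negative, then for every $x\in[\mu^{-1}\bar x,\mu\bar x]$ $$d_T(M_t(x),\bar x)\le e^{-\alpha t}d_T(x,\bar x)$$ for all $t\ge0$ at which $M_t(x)$ is defined; and if the cone $C$ is normal (there is a constant $K$ with $\|x\|\le K\|y\|$ whenever $0\le x\le y$), then $M_t(x)$ is defined for all $t\ge0$, so that the estimate holds for all $t\ge0$. -/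

import Mathlib

namespace Thompson

noncomputable section

variable {X : Type*} [NormedAddCommGroup X] [NormedSpace ℝ X]

/-- The order induced by the cone `C`: `x ≤ y` iff `y - x ∈ C`. -/
def Le (C : ProperCone ℝ X) (x y : X) : Prop := y - x ∈ C

/-- The strict relation `x ≪ y`: `y - x` is in the interior of `C`. -/
def Ll (C : ProperCone ℝ X) (x y : X) : Prop := y - x ∈ interior (C : Set X)

/-- The cone contains no line: `C ∩ (-C) = {0}`. -/
def IsPointed (C : ProperCone ℝ X) : Prop := ∀ x ∈ C, -x ∈ C → x = 0

/-- The cone is normal: `0 ≤ x ≤ y` implies `‖x‖ ≤ K ‖y‖`, for some constant `K`. -/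
def IsNormal (C : ProperCone ℝ X) : Prop :=
  ∃ K : ℝ, ∀ x y : X, Le C 0 x → Le C x y → ‖x‖ ≤ K * ‖y‖

/-- The closed order interval `[x, y]`. -/
def closedInterval (C : ProperCone ℝ X) (x y : X) : Set X := {z | Le C x z ∧ Le C z y}

/-- The open order interval `(x, y)`. -/
def openInterval (C : ProperCone ℝ X) (x y : X) : Set X := {z | Ll C x z ∧ Ll C z y}

/-- `M(x/y) = inf {t : x ≤ t y}`. -/
def upperRatio (C : ProperCone ℝ X) (x y : X) : ℝ := sInf {t : ℝ | Le C x (t • y)}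

/-- `m(x/y) = sup {t : t y ≤ x}`. -/
def lowerRatio (C : ProperCone ℝ X) (x y : X) : ℝ := sSup {t : ℝ | Le C (t • y) x}

/-- The Thompson part metric, for `x` and `y` in the interior of the cone. -/
def dT (C : ProperCone ℝ X) (x y : X) : ℝ :=
  Real.log (max (upperRatio C x y) (upperRatio C y x))

/-- `γ` solves `γ' = φ(γ)`, `γ(0) = x₀` on `[0, b)` with values in `D`. The derivative at `0` is
one-sided, those at `t > 0` are two-sided. When `φ` is continuous on `D`, such a `γ` is
continuously differentiable on `[0, b)`. -/
structure IsSolution (φ : X → X) (D : Set X) (x₀ : X) (b : ℝ) (γ : ℝ → X) : Prop where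
  initial : γ 0 = x₀
  mem : ∀ t : ℝ, 0 ≤ t → t < b → γ t ∈ D
  deriv : ∀ t : ℝ, 0 ≤ t → t < b → HasDerivWithinAt γ (φ (γ t)) (Set.Ici 0) t

/-- The end of the interval `[0, a)` on which the maximal solution issued from `x₀` is defined. -/
def existenceTime (φ : X → X) (D : Set X) (x₀ : X) : EReal :=
  sSup {a : EReal | ∃ b : ℝ, a = (b : EReal) ∧ 0 < b ∧ ∃ γ : ℝ → X, IsSolution φ D x₀ b γ}

open Classical in
/-- The flow `M_t(x₀)`: the value at time `t` of the solution issued from `x₀`. It is meaningful for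
`0 ≤ t < existenceTime φ D x₀`, and it is `0` by convention when no solution reaches time `t`. -/
def flow (φ : X → X) (D : Set X) (t : ℝ) (x₀ : X) : X :=
  if h : ∃ y : X, ∃ b : ℝ, ∃ γ : ℝ → X, IsSolution φ D x₀ b γ ∧ t < b ∧ γ t = y then h.choose else 0

/-- The first time `t_U(x₀)` at which the trajectory issued from `x₀` leaves `U`:
the supremum of the `b ∈ (0, a)`, `a` being the existence time, such that the trajectory stays
in `U` on `[0, b)`. -/
def exitTime (φ : X → X) (D U : Set X) (x₀ : X) : EReal :=
  sSup {a : EReal | ∃ b : ℝ, a = (b : EReal) ∧ 0 < b ∧ a < existenceTime φ D x₀ ∧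
    ∀ t : ℝ, 0 ≤ t → t < b → flow φ D t x₀ ∈ U}

/-- The flow of `φ` on the domain `D` is order-preserving on `U`. -/
def OrderPreservingOn (C : ProperCone ℝ X) (φ : X → X) (D U : Set X) : Prop :=
  ∀ x₁ ∈ U, ∀ x₂ ∈ U, Le C x₂ x₁ → ∀ t : ℝ, 0 ≤ t →
    (t : EReal) < min (exitTime φ D U x₁) (exitTime φ D U x₂) →
    Le C (flow φ D t x₂) (flow φ D t x₁)

/-- `φ` is Fréchet differentiable on the open set `D`, with a derivative that is bounded on each
closed bounded set contained in `D`. -/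
def IsAdmissible (φ : X → X) (D : Set X) : Prop :=
  (∀ x ∈ D, DifferentiableAt ℝ φ x) ∧
    ∀ K : Set X, K ⊆ D → IsClosed K → Bornology.IsBounded K →
      ∃ L : ℝ, ∀ x ∈ K, ‖fderiv ℝ φ x‖ ≤ L

end

end Thompson

/-!
The curves `exp (± d * exp (-α * t)) • x̄` on the ray of the equilibrium `x̄` bound a
part-metric ball around `x̄` whose radius `d * exp (-α * t)` decays at the rate `α`. An
order-preserving flow keeps a trajectory inside this shrinking ball as soon as the upper curve
is a supersolution and the lower one a subsolution. Both conditions depend on the values of `φ`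
on the ray alone, and dividing them by `l * log l` at the point `l • x̄` shows that they hold
within distance `log μ` of `x̄` exactly when `α` is a lower bound of the ratios
`m (-(l * log l)⁻¹ φ(l x̄) / x̄)`. Conversely, differentiating at `t = 0` the contraction of a
trajectory issued from `l • x̄` recovers the condition at `l`. The rates of contraction are
therefore the lower bounds of the set of ratios, and the greatest rate is its infimum.

If the rate is non-negative, then trajectories stay in `[μ⁻¹ x̄, μ x̄]`. For a normal cone a
neighbourhood of fixed radius of this interval lies in a closed bounded convex subset of the
interior of the cone, on which `φ` is Lipschitz and bounded, so solutions issued from the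
interval exist for a common time and are global.
-/

namespace Thompson

open Set Metric Filter Topology
open scoped NNReal Pointwise

section ConeOrder

variable {X : Type*} [NormedAddCommGroup X] [NormedSpace ℝ X] {C : ProperCone ℝ X} {x y z : X}

theorem add_mem_interior (hx : x ∈ interior (C : Set X)) (hy : y ∈ C) :
    x + y ∈ interior (C : Set X) := by
  have hadd : (C : Set X) + (C : Set X) ⊆ (C : Set X) := by
    rintro _ ⟨a, ha, b, hb, rfl⟩
    exact add_mem (S := Submodule _ X) ha hb
  exact interior_mono hadd (subset_interior_add_left (add_mem_add hx hy))

theorem smul_mem_interior {r : ℝ} (hr : 0 < r) (hx : x ∈ interior (C : Set X)) :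
    r • x ∈ interior (C : Set X) := by
  have hsmul : r • (C : Set X) ⊆ (C : Set X) := by
    rintro _ ⟨a, ha, rfl⟩
    exact C.smul_mem ha hr.le
  exact interior_mono hsmul (interior_smul₀ hr.ne' (C : Set X) ▸ smul_mem_smul_set hx)

theorem exists_closedBall_subset (hx : x ∈ interior (C : Set X)) :
    ∃ δ : ℝ, 0 < δ ∧ closedBall x δ ⊆ (C : Set X) :=
  nhds_basis_closedBall.mem_iff.1 (mem_interior_iff_mem_nhds.1 hx)

theorem norm_div_smul_add_mem {δ : ℝ} (hδ : 0 < δ) (hy : closedBall y δ ⊆ (C : Set X)) (x : X) :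
    (‖x‖ / δ) • y + x ∈ C := by
  rcases eq_or_ne x 0 with rfl | hx
  · simp
  · have hpos : 0 < ‖x‖ / δ := by positivity
    have hmem : y + (‖x‖ / δ)⁻¹ • x ∈ C := by
      refine hy ?_
      rw [mem_closedBall_iff_norm, add_sub_cancel_left, norm_smul,
        Real.norm_of_nonneg (inv_pos.2 hpos).le, inv_div, div_mul_cancel₀ _ (norm_ne_zero_iff.2 hx)]
    have hscaled := C.smul_mem hmem hpos.le
    rwa [smul_add, smul_inv_smul₀ hpos.ne'] at hscaled

theorem smul_add_mem {δ r : ℝ} {v : X} (hδ : 0 < δ) (hx : closedBall x δ ⊆ (C : Set X))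
    (hv : ‖v‖ ≤ r * δ) : r • x + v ∈ C := by
  have hr : 0 ≤ r - ‖v‖ / δ := sub_nonneg.2 ((div_le_iff₀ hδ).2 hv)
  have hsum := add_mem (S := Submodule _ X) (C.smul_mem (hx (mem_closedBall_self hδ.le)) hr)
    (norm_div_smul_add_mem hδ hx v)
  rwa [← add_assoc, ← add_smul, sub_add_cancel] at hsum

theorem smul_add_mem_interior {δ r : ℝ} {v : X} (hδ : 0 < δ) (hx : closedBall x δ ⊆ (C : Set X))
    (hv : ‖v‖ < r * δ) : r • x + v ∈ interior (C : Set X) := by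
  have hmem : x ∈ interior (C : Set X) :=
    mem_interior_iff_mem_nhds.2 (mem_of_superset (closedBall_mem_nhds x hδ) hx)
  have hpos : 0 < r - ‖v‖ / δ := sub_pos.2 ((div_lt_iff₀ hδ).2 hv)
  have hsum := add_mem_interior (smul_mem_interior hpos hmem) (norm_div_smul_add_mem hδ hx v)
  rwa [← add_assoc, ← add_smul, sub_add_cancel] at hsum

theorem IsPointed.zero_notMem_interior [Nontrivial X] (hC : IsPointed C) :
    (0 : X) ∉ interior (C : Set X) := by
  intro h
  obtain ⟨δ, hδ, hball⟩ := exists_closedBall_subset h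
  have hall : ∀ x : X, x ∈ C := fun x => by simpa using norm_div_smul_add_mem hδ hball x
  obtain ⟨x, hx⟩ := exists_ne (0 : X)
  exact hx (hC x (hall x) (hall (-x)))

theorem neg_notMem_of_mem_interior (h0 : (0 : X) ∉ interior (C : Set X))
    (hx : x ∈ interior (C : Set X)) : -x ∉ C :=
  fun h => h0 (by simpa using add_mem_interior hx h)

theorem nonneg_of_smul_mem (h0 : (0 : X) ∉ interior (C : Set X)) (hx : x ∈ interior (C : Set X))
    {r : ℝ} (h : r • x ∈ C) : 0 ≤ r := by
  by_contra! hr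
  exact neg_notMem_of_mem_interior h0 (smul_mem_interior (neg_pos.2 hr) hx) (by simpa using h)

theorem Le.trans (hxy : Le C x y) (hyz : Le C y z) : Le C x z := by
  have : z - y + (y - x) ∈ C := add_mem (S := Submodule _ X) hyz hxy
  rwa [sub_add_sub_cancel] at this

theorem Ll.le (h : Ll C x y) : Le C x y :=
  interior_subset h

theorem mem_interior_of_le (hx : x ∈ interior (C : Set X)) (h : Le C x y) :
    y ∈ interior (C : Set X) :=
  add_sub_cancel x y ▸ add_mem_interior hx h

theorem smul_le_smul_iff {c : ℝ} (hc : 0 < c) : Le C (c • x) (c • y) ↔ Le C x y := by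
  rw [Le, ← smul_sub]
  exact C.toPointedCone.smul_mem_iff hc

theorem smul_le_smul_right {a b : ℝ} (hab : a ≤ b) (hx : x ∈ C) : Le C (a • x) (b • x) := by
  rw [Le, ← sub_smul]
  exact C.smul_mem hx (sub_nonneg.2 hab)

theorem smul_ll_smul_right {a b : ℝ} (hab : a < b) (hx : x ∈ interior (C : Set X)) :
    Ll C (a • x) (b • x) := by
  rw [Ll, ← sub_smul]
  exact smul_mem_interior (sub_pos.2 hab) hx

theorem eventually_sub_mem_of_hasDerivWithinAt {F : ℝ → X} {v : X} {s : ℝ}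
    (hF : HasDerivWithinAt F v (Ici s) s) (hv : v ∈ interior (C : Set X)) :
    ∀ᶠ t in 𝓝[>] s, F t - F s ∈ C := by
  have hslope := hasDerivWithinAt_iff_tendsto_slope.1 hF
  rw [Ici_sdiff_left] at hslope
  filter_upwards [hslope.eventually (isOpen_interior.mem_nhds hv), self_mem_nhdsWithin]
    with t ht hst
  rw [← vsub_eq_sub, ← sub_smul_slope F s t]
  exact C.smul_mem (interior_subset ht) (sub_pos.2 hst).le

theorem mem_of_hasDerivWithinAt {F : ℝ → X} {v : X} {s : ℝ}
    (hF : HasDerivWithinAt F v (Ici s) s) (h : ∀ᶠ t in 𝓝[>] s, F t - F s ∈ C) : v ∈ C := by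
  have hslope := hasDerivWithinAt_iff_tendsto_slope.1 hF
  rw [Ici_sdiff_left] at hslope
  refine C.isClosed.mem_of_tendsto hslope ?_
  filter_upwards [h, self_mem_nhdsWithin] with t ht hst
  exact C.smul_mem ht (inv_pos.2 (sub_pos.2 hst)).le

end ConeOrder

section ThompsonMetric

variable {X : Type*} [NormedAddCommGroup X] [NormedSpace ℝ X] {C : ProperCone ℝ X} {x y e : X}

theorem upperRatio_le_iff (h0 : (0 : X) ∉ interior (C : Set X)) (hy : y ∈ interior (C : Set X))
    {t : ℝ} : upperRatio C x y ≤ t ↔ Le C x (t • y) := by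
  obtain ⟨δ, hδ, hball⟩ := exists_closedBall_subset hy
  have hbdd : BddBelow {t : ℝ | Le C x (t • y)} := by
    refine ⟨-(‖x‖ / δ), fun t ht => ?_⟩
    have hsum : (t + ‖x‖ / δ) • y ∈ C := by
      have := add_mem (S := Submodule _ X) ht (norm_div_smul_add_mem hδ hball x)
      rwa [sub_add_add_cancel, ← add_smul] at this
    linarith [nonneg_of_smul_mem h0 hy hsum]
  have hne : {t : ℝ | Le C x (t • y)}.Nonempty :=
    ⟨‖x‖ / δ, by simpa [Le, sub_eq_add_neg] using norm_div_smul_add_mem hδ hball (-x)⟩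
  have hclosed : IsClosed {t : ℝ | Le C x (t • y)} := C.isClosed.preimage (by fun_prop)
  have hmin : Le C x (upperRatio C x y • y) := hclosed.csInf_mem hne hbdd
  exact ⟨fun h => hmin.trans (smul_le_smul_right h (interior_subset hy)), fun h => csInf_le hbdd h⟩

theorem lowerRatio_eq_neg_upperRatio_neg : lowerRatio C x y = -upperRatio C (-x) y := by
  rw [lowerRatio, upperRatio, ← Real.sSup_neg]
  congr 1
  ext t
  simp [Le, add_comm, ← sub_eq_add_neg]

theorem le_lowerRatio_iff (h0 : (0 : X) ∉ interior (C : Set X)) (hy : y ∈ interior (C : Set X))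
    {t : ℝ} : t ≤ lowerRatio C x y ↔ Le C (t • y) x := by
  rw [lowerRatio_eq_neg_upperRatio_neg, le_neg, upperRatio_le_iff h0 hy]
  simp [Le, add_comm, ← sub_eq_add_neg]

theorem upperRatio_pos (h0 : (0 : X) ∉ interior (C : Set X)) (hx : x ∈ interior (C : Set X))
    (hy : y ∈ interior (C : Set X)) : 0 < upperRatio C x y := by
  by_contra! h
  have hle := (upperRatio_le_iff h0 hy).1 h
  exact neg_notMem_of_mem_interior h0 hx (by simpa [Le] using hle)

theorem le_exp_smul_iff {r : ℝ} : Le C x (Real.exp r • y) ↔ Le C (Real.exp (-r) • x) y := by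
  rw [← smul_le_smul_iff (Real.exp_pos (-r)), smul_smul, ← Real.exp_add]
  simp

theorem dT_le_iff (h0 : (0 : X) ∉ interior (C : Set X)) (hx : x ∈ interior (C : Set X))
    (hy : y ∈ interior (C : Set X)) {r : ℝ} :
    dT C x y ≤ r ↔ Le C x (Real.exp r • y) ∧ Le C (Real.exp (-r) • y) x := by
  rw [dT, Real.log_le_iff_le_exp (lt_max_of_lt_left (upperRatio_pos h0 hx hy)), max_le_iff,
    upperRatio_le_iff h0 hy, upperRatio_le_iff h0 hx, le_exp_smul_iff (x := y)]

theorem dT_nonneg (h0 : (0 : X) ∉ interior (C : Set X)) (hx : x ∈ interior (C : Set X))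
    (hy : y ∈ interior (C : Set X)) : 0 ≤ dT C x y := by
  obtain ⟨hle, hge⟩ := (dT_le_iff h0 hx hy).1 le_rfl
  have hdiff := hge.trans hle
  rw [Le, ← sub_smul] at hdiff
  linarith [Real.exp_le_exp.1 (sub_nonneg.1 (nonneg_of_smul_mem h0 hy hdiff))]

theorem closedInterval_subset_interior (hx : x ∈ interior (C : Set X)) :
    closedInterval C x y ⊆ interior (C : Set X) :=
  fun _ hz => mem_interior_of_le hx hz.1

theorem openInterval_subset_closedInterval : openInterval C x y ⊆ closedInterval C x y :=
  fun _ hz => ⟨hz.1.le, hz.2.le⟩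

theorem mem_closedInterval_iff_dT_le (h0 : (0 : X) ∉ interior (C : Set X))
    (hx : x ∈ interior (C : Set X)) (he : e ∈ interior (C : Set X)) {μ : ℝ} (hμ : 0 < μ) :
    x ∈ closedInterval C (μ⁻¹ • e) (μ • e) ↔ dT C x e ≤ Real.log μ := by
  rw [dT_le_iff h0 hx he, Real.exp_neg, Real.exp_log hμ]
  exact and_comm

theorem dT_exp_smul_self_le (h0 : (0 : X) ∉ interior (C : Set X)) (he : e ∈ interior (C : Set X))
    (c : ℝ) : dT C (Real.exp c • e) e ≤ |c| := by
  rw [dT_le_iff h0 (smul_mem_interior (Real.exp_pos c) he) he]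
  exact ⟨smul_le_smul_right (Real.exp_le_exp.2 (le_abs_self c)) (interior_subset he),
    smul_le_smul_right (Real.exp_le_exp.2 (neg_abs_le c)) (interior_subset he)⟩

theorem smul_exp_smul_sub_mem (h0 : (0 : X) ∉ interior (C : Set X))
    (hx : x ∈ interior (C : Set X)) (he : e ∈ interior (C : Set X)) {c : ℝ}
    (h : dT C x e ≤ |c|) : c • (Real.exp c • e - x) ∈ C := by
  obtain ⟨hle, hge⟩ := (dT_le_iff h0 hx he).1 h
  rcases le_total 0 c with hc | hc
  · rw [abs_of_nonneg hc] at hle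
    exact C.smul_mem hle hc
  · rw [abs_of_nonpos hc, neg_neg] at hge
    rw [← neg_smul_neg, neg_sub]
    exact C.smul_mem hge (neg_nonneg.2 hc)

end ThompsonMetric

section LipschitzOn

variable {α β : Type*} [PseudoMetricSpace α] [SeminormedAddCommGroup β] {f : α → β} {D S : Set α}

theorem exists_closedBall_lipschitzOnWith {x : α} (hD : IsOpen D)
    (hL : LocallyLipschitzOn D f) (hx : x ∈ D) :
    ∃ (K : ℝ≥0) (r : ℝ), 0 < r ∧ closedBall x r ⊆ D ∧ LipschitzOnWith K f (closedBall x r) := by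
  obtain ⟨K, t, ht, hK⟩ := hL hx
  rw [hD.nhdsWithin_eq hx] at ht
  obtain ⟨r, hr, hball⟩ := nhds_basis_closedBall.mem_iff.1 (inter_mem ht (hD.mem_nhds hx))
  exact ⟨K, r, hr, hball.trans inter_subset_right, hK.mono (hball.trans inter_subset_left)⟩

theorem exists_pos_norm_le_of_lipschitzOnWith {K : ℝ≥0} (hK : LipschitzOnWith K f S)
    (hS : Bornology.IsBounded S) : ∃ B : ℝ, 0 < B ∧ ∀ y ∈ S, ‖f y‖ ≤ B := by
  have huniv : Bornology.IsBounded (univ : Set S) :=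
    Bornology.isBounded_univ.2 (boundedSpace_subtype_iff.2 hS)
  have himage := hK.to_restrict.isBounded_image huniv
  rw [image_univ, range_domRestrict] at himage
  obtain ⟨B, hB, h⟩ := himage.exists_pos_norm_le
  exact ⟨B, hB, fun y hy => h _ (mem_image_of_mem f hy)⟩

end LipschitzOn

section Solutions

variable {X : Type*} [NormedAddCommGroup X] [NormedSpace ℝ X] {φ : X → X} {D S : Set X} {x : X}

/-- `φ` is Lipschitz on every closed bounded convex subset of `D`. This is admissibility with the
bound on the derivative integrated, so that it applies to vector fields with corners. -/
def LipschitzOnBoundedConvex (φ : X → X) (D : Set X) : Prop :=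
  ∀ S ⊆ D, IsClosed S → Bornology.IsBounded S → Convex ℝ S → ∃ K : ℝ≥0, LipschitzOnWith K φ S

theorem IsAdmissible.lipschitzOnBoundedConvex (hφ : IsAdmissible φ D) :
    LipschitzOnBoundedConvex φ D := by
  intro S hSD hclosed hbdd hconv
  obtain ⟨L, hL⟩ := hφ.2 S hSD hclosed hbdd
  exact ⟨L.toNNReal, hconv.lipschitzOnWith_of_nnnorm_fderiv_le (fun x hx => hφ.1 x (hSD hx))
    fun x hx => NNReal.le_toNNReal_of_coe_le (hL x hx)⟩

theorem LipschitzOnBoundedConvex.locallyLipschitzOn (hφ : LipschitzOnBoundedConvex φ D)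
    (hD : IsOpen D) : LocallyLipschitzOn D φ := by
  intro x hx
  obtain ⟨r, hr, hball⟩ := nhds_basis_closedBall.mem_iff.1 (hD.mem_nhds hx)
  obtain ⟨K, hK⟩ := hφ _ hball isClosed_closedBall isBounded_closedBall (convex_closedBall x r)
  exact ⟨K, _, mem_nhdsWithin_of_mem_nhds (closedBall_mem_nhds x hr), hK⟩

theorem hasDerivWithinAt_comp_sub_const {γ : ℝ → X} {v : X} {c t : ℝ}
    (h : HasDerivWithinAt γ v (Ici 0) (t - c)) :
    HasDerivWithinAt (fun s => γ (s - c)) v (Ici c) t := by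
  have hcomp : HasDerivWithinAt (fun s => γ (s - c)) ((1 : ℝ) • v) (Ici c) t :=
    h.scomp t ((hasDerivAt_id t).sub_const c).hasDerivWithinAt fun _ hr => sub_nonneg.2 hr
  rwa [one_smul] at hcomp

namespace IsSolution

variable {b c t : ℝ} {γ η : ℝ → X}

theorem mono (h : IsSolution φ D x b γ) (hcb : c ≤ b) : IsSolution φ D x c γ :=
  ⟨h.initial, fun t h0 ht => h.mem t h0 (ht.trans_le hcb),
    fun t h0 ht => h.deriv t h0 (ht.trans_le hcb)⟩

theorem hasDerivWithinAt_Ici (h : IsSolution φ D x b γ) (h0 : 0 ≤ t) (ht : t < b) :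
    HasDerivWithinAt γ (φ (γ t)) (Ici t) t :=
  (h.deriv t h0 ht).mono (Ici_subset_Ici.2 h0)

theorem continuousOn (h : IsSolution φ D x b γ) : ContinuousOn γ (Ico 0 b) :=
  fun t ht => (h.deriv t ht.1 ht.2).continuousWithinAt.mono Ico_subset_Ici_self

theorem glue (h : IsSolution φ D x b γ) (hc : 0 ≤ c) (hcb : c < b)
    (hη : IsSolution φ D (γ c) t η) : ∃ ζ : ℝ → X, IsSolution φ D x (c + t) ζ := by
  let ζ : ℝ → X := fun s => if s ≤ c then γ s else η (s - c)
  have hζ_left : ∀ s ≤ c, ζ s = γ s := fun s hs => if_pos hs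
  have hζ_right : ∀ s, c ≤ s → ζ s = η (s - c) := by
    intro s hs
    rcases hs.eq_or_lt with rfl | hs
    · rw [hζ_left c le_rfl, sub_self, hη.initial]
    · exact if_neg hs.not_ge
  have hderiv_left : ∀ s, 0 ≤ s → HasDerivWithinAt ζ (φ (ζ s)) (Icc 0 c) s := by
    intro s h0
    rcases le_or_gt s c with hsc | hcs
    · rw [hζ_left s hsc]
      exact ((h.deriv s h0 (hsc.trans_lt hcb)).mono Icc_subset_Ici_self).congr
        (fun r hr => hζ_left r hr.2) (hζ_left s hsc)
    · exact hasDerivWithinAt_iff_hasFDerivWithinAt.2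
        (.of_notMem_closure (by simpa using fun _ => hcs))
  have hderiv_right : ∀ s, s < c + t → HasDerivWithinAt ζ (φ (ζ s)) (Ici c) s := by
    intro s hst
    rcases le_or_gt c s with hcs | hsc
    · rw [hζ_right s hcs]
      exact (hasDerivWithinAt_comp_sub_const (hη.deriv (s - c) (by linarith) (by linarith))).congr
        hζ_right (hζ_right s hcs)
    · exact hasDerivWithinAt_iff_hasFDerivWithinAt.2 (.of_notMem_closure (by simpa using hsc))
  refine ⟨ζ, (hζ_left 0 hc).trans h.initial, fun s h0 hst => ?_, fun s h0 hst => ?_⟩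
  · rcases le_total s c with hsc | hcs
    · exact hζ_left s hsc ▸ h.mem s h0 (hsc.trans_lt hcb)
    · exact hζ_right s hcs ▸ hη.mem _ (by linarith) (by linarith)
  · exact Icc_union_Ici_eq_Ici hc ▸ (hderiv_left s h0).union (hderiv_right s hst)

theorem eventually_eq_of_eq (hD : IsOpen D) (hL : LocallyLipschitzOn D φ)
    (h : IsSolution φ D x b γ) (h' : IsSolution φ D x c η) (h0 : 0 ≤ t) (hb : t < b) (hc : t < c)
    (heq : γ t = η t) : ∀ᶠ s in 𝓝[>] t, γ s = η s := by
  obtain ⟨K, r, hr, -, hK⟩ := exists_closedBall_lipschitzOnWith hD hL (h.mem t h0 hb)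
  have hγ : ∀ᶠ s in 𝓝[≥] t, γ s ∈ closedBall (γ t) r :=
    (h.hasDerivWithinAt_Ici h0 hb).continuousWithinAt.eventually (closedBall_mem_nhds _ hr)
  have hη : ∀ᶠ s in 𝓝[≥] t, η s ∈ closedBall (γ t) r :=
    (h'.hasDerivWithinAt_Ici h0 hc).continuousWithinAt.eventually
      (heq ▸ closedBall_mem_nhds _ hr)
  have hlt : ∀ᶠ s in 𝓝[≥] t, s < min b c :=
    mem_nhdsWithin_of_mem_nhds (Iio_mem_nhds (lt_min hb hc))
  obtain ⟨w, htw, hw⟩ := mem_nhdsGE_iff_exists_Icc_subset.1 ((hγ.and hη).and hlt)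
  have hsub : Icc t w ⊆ Ico 0 b ∩ Ico 0 c := fun s hs =>
    ⟨⟨h0.trans hs.1, (hw hs).2.trans_le (min_le_left b c)⟩,
      ⟨h0.trans hs.1, (hw hs).2.trans_le (min_le_right b c)⟩⟩
  have heqOn : EqOn γ η (Icc t w) :=
    ODE_solution_unique_of_mem_Icc_right (v := fun _ => φ) (fun _ _ => hK)
      (h.continuousOn.mono (hsub.trans inter_subset_left))
      (fun s hs => h.hasDerivWithinAt_Ici (h0.trans hs.1) (hsub ⟨hs.1, hs.2.le⟩).1.2)
      (fun s hs => (hw ⟨hs.1, hs.2.le⟩).1.1)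
      (h'.continuousOn.mono (hsub.trans inter_subset_right))
      (fun s hs => h'.hasDerivWithinAt_Ici (h0.trans hs.1) (hsub ⟨hs.1, hs.2.le⟩).2.2)
      (fun s hs => (hw ⟨hs.1, hs.2.le⟩).1.2) heq
  filter_upwards [Icc_mem_nhdsGT htw] with s hs using heqOn hs

theorem eq_of_isSolution (hD : IsOpen D) (hL : LocallyLipschitzOn D φ)
    (h : IsSolution φ D x b γ) (h' : IsSolution φ D x c η) (h0 : 0 ≤ t) (hb : t < b)
    (hc : t < c) : γ t = η t := by
  have hcont : ContinuousOn (fun s => (γ s, η s)) (Icc 0 t) :=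
    (h.continuousOn.mono (Icc_subset_Ico_right hb)).prodMk
      (h'.continuousOn.mono (Icc_subset_Ico_right hc))
  have hclosed : IsClosed ({s | γ s = η s} ∩ Icc 0 t) :=
    inter_comm _ _ ▸ hcont.preimage_isClosed_of_isClosed isClosed_Icc isClosed_diagonal
  exact hclosed.Icc_subset_of_forall_mem_nhdsWithin (h.initial.trans h'.initial.symm)
    (fun s hs => h.eventually_eq_of_eq hD hL h' hs.2.1 (hs.2.2.trans hb) (hs.2.2.trans hc) hs.1)
    ⟨h0, le_rfl⟩

theorem flow_eq (hD : IsOpen D) (hL : LocallyLipschitzOn D φ) (h : IsSolution φ D x b γ)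
    (h0 : 0 ≤ t) (ht : t < b) : flow φ D t x = γ t := by
  have hex : ∃ y : X, ∃ b : ℝ, ∃ γ : ℝ → X, IsSolution φ D x b γ ∧ t < b ∧ γ t = y :=
    ⟨γ t, b, γ, h, ht, rfl⟩
  obtain ⟨c, η, hη, htc, hηt⟩ := hex.choose_spec
  rw [flow, dif_pos hex, ← hηt]
  exact hη.eq_of_isSolution hD hL h h0 htc ht

theorem lt_existenceTime (h : IsSolution φ D x b γ) (h0 : 0 ≤ t) (ht : t < b) :
    (t : EReal) < existenceTime φ D x :=
  (EReal.coe_lt_coe_iff.2 ht).trans_le (le_sSup ⟨b, rfl, h0.trans_lt ht, γ, h⟩)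

theorem lt_exitTime {U : Set X} (hD : IsOpen D) (hL : LocallyLipschitzOn D φ)
    (h : IsSolution φ D x b γ) (h0 : 0 ≤ t) (ht : t < b) (hU : ∀ s, 0 ≤ s → s < b → γ s ∈ U) :
    (t : EReal) < exitTime φ D U x := by
  obtain ⟨d, htd, hdb⟩ := exists_between ht
  refine (EReal.coe_lt_coe_iff.2 htd).trans_le (le_sSup ⟨d, rfl, h0.trans_lt htd,
    h.lt_existenceTime (h0.trans htd.le) hdb, fun s hs0 hsd => ?_⟩)
  rw [h.flow_eq hD hL hs0 (hsd.trans hdb)]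
  exact hU s hs0 (hsd.trans hdb)

end IsSolution

theorem IsSolution.hasDerivWithinAt_comp_sub {b : ℝ} {γ : ℝ → X} (h : IsSolution φ D x b γ)
    (hb : 0 < b) (t : ℝ) : HasDerivWithinAt (fun s => γ (s - t)) (φ x) (Ici t) t := by
  have hderiv := h.deriv 0 le_rfl hb
  rw [h.initial] at hderiv
  exact hasDerivWithinAt_comp_sub_const ((sub_self t).symm ▸ hderiv)

theorem exists_isSolution_of_lt_existenceTime {t : ℝ} (h : (t : EReal) < existenceTime φ D x) :
    ∃ b : ℝ, t < b ∧ ∃ γ : ℝ → X, IsSolution φ D x b γ := by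
  obtain ⟨_, ⟨b, rfl, -, γ, hγ⟩, hb⟩ := lt_sSup_iff.1 h
  exact ⟨b, EReal.coe_lt_coe_iff.1 hb, γ, hγ⟩

theorem exists_isSolution_of_lt_exitTime {U : Set X} {t : ℝ} (hD : IsOpen D)
    (hL : LocallyLipschitzOn D φ) (h : (t : EReal) < exitTime φ D U x) :
    ∃ b : ℝ, t < b ∧ ∃ γ : ℝ → X, IsSolution φ D x b γ ∧ ∀ s, 0 ≤ s → s < b → γ s ∈ U := by
  obtain ⟨_, ⟨b, rfl, -, hlt, hU⟩, hb⟩ := lt_sSup_iff.1 h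
  obtain ⟨c, hc, γ, hγ⟩ := exists_isSolution_of_lt_existenceTime hlt
  refine ⟨b, EReal.coe_lt_coe_iff.1 hb, γ, hγ.mono hc.le, fun s h0 hs => ?_⟩
  rw [← hγ.flow_eq hD hL h0 (hs.trans hc)]
  exact hU s h0 hs

-- Mathlib's existence theorems do not say that the solution stays in the ball, but the fixed point
-- of the Picard operator that underlies them does.
theorem exists_isSolution_of_lipschitzOnWith_closedBall [CompleteSpace X] {K : ℝ≥0} {r B τ : ℝ}
    (hD : closedBall x r ⊆ D) (hK : LipschitzOnWith K φ (closedBall x r))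
    (hB : ∀ y ∈ closedBall x r, ‖φ y‖ ≤ B) (hr : 0 ≤ r) (hτ : 0 < τ) (hBτ : B * τ ≤ r) :
    ∃ γ : ℝ → X, IsSolution φ D x τ γ := by
  have hB0 : 0 ≤ B := (norm_nonneg _).trans (hB x (mem_closedBall_self hr))
  lift r to ℝ≥0 using hr
  lift B to ℝ≥0 using hB0
  let t₀ : Icc 0 τ := ⟨0, le_rfl, hτ.le⟩
  have hP : IsPicardLindelof (fun _ => φ) t₀ x r 0 B K :=
    .of_time_independent hB hK (by simpa [t₀, hτ.le] using hBτ)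
  obtain ⟨α, hα⟩ := ODE.FunSpace.exists_isFixedPt_next hP (mem_closedBall_self le_rfl)
  have hmem : ∀ t, α.compProj t ∈ closedBall x r := fun t => α.compProj_mem_closedBall hP.mul_max_le
  refine ⟨α.compProj, ?_, fun t _ _ => hD (hmem t), fun t h0 ht => ?_⟩
  · have hstart := ODE.FunSpace.compProj_val (α := α) (t := t₀)
    rwa [← hα, ODE.FunSpace.next_apply₀, hα] at hstart
  · have hderiv : HasDerivWithinAt α.compProj (φ (α.compProj t)) (Icc 0 τ) t := by
      refine (ODE.hasDerivWithinAt_picard_Icc t₀.2 hP.continuousOn_uncurry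
        α.continuous_compProj.continuousOn (fun _ _ => hmem _) x ⟨h0, ht.le⟩).congr_of_mem ?_
        ⟨h0, ht.le⟩
      intro s hs
      nth_rw 1 [← hα]
      rw [ODE.FunSpace.compProj_of_mem hs, ODE.FunSpace.next_apply]
    exact hderiv.mono_of_mem_nhdsWithin (Ici_inter_Iic (a := (0 : ℝ)) ▸
      inter_mem self_mem_nhdsWithin (mem_nhdsWithin_of_mem_nhds (Iic_mem_nhds ht)))

theorem exists_forall_isSolution_of_closedBall_subset [CompleteSpace X] {K : ℝ≥0} {δ : ℝ}
    (hK : LipschitzOnWith K φ S) (hS : Bornology.IsBounded S) (hSD : S ⊆ D) (hδ : 0 < δ) :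
    ∃ τ : ℝ, 0 < τ ∧ ∀ z, closedBall z δ ⊆ S → ∃ γ : ℝ → X, IsSolution φ D z τ γ := by
  obtain ⟨B, hB, hφB⟩ := exists_pos_norm_le_of_lipschitzOnWith hK hS
  exact ⟨δ / B, by positivity, fun z hz => exists_isSolution_of_lipschitzOnWith_closedBall
    (hz.trans hSD) (hK.mono hz) (fun y hy => hφB y (hz hy)) hδ.le (by positivity)
    (mul_div_cancel₀ δ hB.ne').le⟩

theorem exists_isSolution [CompleteSpace X] (hD : IsOpen D) (hL : LocallyLipschitzOn D φ)
    (hx : x ∈ D) : ∃ b : ℝ, 0 < b ∧ ∃ γ : ℝ → X, IsSolution φ D x b γ := by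
  obtain ⟨K, r, hr, hball, hK⟩ := exists_closedBall_lipschitzOnWith hD hL hx
  obtain ⟨τ, hτ, hsol⟩ := exists_forall_isSolution_of_closedBall_subset hK isBounded_closedBall
    hball hr
  exact ⟨τ, hτ, hsol x le_rfl⟩

theorem existenceTime_eq_top_of_forall_mem {τ : ℝ} (hτ : 0 < τ)
    (hS : ∀ z ∈ S, ∃ γ : ℝ → X, IsSolution φ D z τ γ) (hx : x ∈ S)
    (hstay : ∀ b γ, IsSolution φ D x b γ → ∀ t, 0 ≤ t → t < b → γ t ∈ S) :
    existenceTime φ D x = ⊤ := by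
  by_contra hne
  obtain ⟨γ₀, hγ₀⟩ := hS x hx
  have hlt : ∀ t, 0 ≤ t → t < τ → (t : EReal) < existenceTime φ D x :=
    fun t h0 ht => hγ₀.lt_existenceTime h0 ht
  have hbot : existenceTime φ D x ≠ ⊥ := (bot_le.trans_lt (hlt 0 le_rfl hτ)).ne'
  lift existenceTime φ D x to ℝ using ⟨hne, hbot⟩ with T hT
  have hτT : τ / 2 < T := EReal.coe_lt_coe_iff.1 (hlt _ (by linarith) (by linarith))
  obtain ⟨b, hb, γ, hγ⟩ := exists_isSolution_of_lt_existenceTime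
    (hT ▸ EReal.coe_lt_coe_iff.2 (by linarith : T - τ / 2 < T))
  obtain ⟨η, hη⟩ := hS _ (hstay b γ hγ _ (by linarith) hb)
  obtain ⟨ζ, hζ⟩ := hγ.glue (by linarith) hb hη
  exact (hT ▸ hζ.lt_existenceTime (t := T) (by linarith) (by linarith)).false

end Solutions

section Comparison

variable {X : Type*} [NormedAddCommGroup X] [NormedSpace ℝ X] {C : ProperCone ℝ X} {φ : X → X}
  {D : Set X} {a b p q : ℝ → X} {s t T : ℝ}

/-- `a` follows the vector field `φ` on `[s, T]` with the forcing `p`, that is `a' = φ(a) + p`, the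
derivatives being one-sided. A subsolution is the case `p ≤ 0`, a supersolution the case `0 ≤ p`. -/
structure IsForcedSolutionOn (φ : X → X) (D : Set X) (p : ℝ → X) (s T : ℝ) (a : ℝ → X) :
    Prop where
  continuousOn : ContinuousOn a (Icc s T)
  mem : ∀ t ∈ Ico s T, a t ∈ D
  deriv : ∀ t ∈ Ico s T, HasDerivWithinAt a (φ (a t) + p t) (Ici t) t

theorem IsSolution.isForcedSolutionOn {x : X} {c : ℝ} {γ : ℝ → X} (h : IsSolution φ D x c γ)
    (hT : T < c) : IsForcedSolutionOn φ D (fun _ => 0) 0 T γ where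
  continuousOn := h.continuousOn.mono (Icc_subset_Ico_right hT)
  mem t ht := h.mem t ht.1 (ht.2.trans hT)
  deriv t ht := by
    rw [add_zero]
    exact h.hasDerivWithinAt_Ici ht.1 (ht.2.trans hT)

theorem IsForcedSolutionOn.mono {s' T' : ℝ} (h : IsForcedSolutionOn φ D p s T a) (hs : s ≤ s')
    (hT : T' ≤ T) : IsForcedSolutionOn φ D p s' T' a where
  continuousOn := h.continuousOn.mono (Icc_subset_Icc hs hT)
  mem t ht := h.mem t (Ico_subset_Ico hs hT ht)
  deriv t ht := h.deriv t (Ico_subset_Ico hs hT ht)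

theorem isClosed_setOf_le_inter_Icc (ha : ContinuousOn a (Icc s T))
    (hb : ContinuousOn b (Icc s T)) : IsClosed ({t | Le C (a t) (b t)} ∩ Icc s T) :=
  inter_comm _ _ ▸ (hb.sub ha).preimage_isClosed_of_isClosed isClosed_Icc C.isClosed

theorem OrderPreservingOn.le_of_isSolution (hmono : OrderPreservingOn C φ D D) (hD : IsOpen D)
    (hL : LocallyLipschitzOn D φ) {x y : X} {c : ℝ} {γ η : ℝ → X} (hγ : IsSolution φ D x c γ)
    (hη : IsSolution φ D y c η) (hxy : Le C x y) (h0 : 0 ≤ t) (ht : t < c) :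
    Le C (γ t) (η t) := by
  have hx : x ∈ D := hγ.initial ▸ hγ.mem 0 le_rfl (h0.trans_lt ht)
  have hy : y ∈ D := hη.initial ▸ hη.mem 0 le_rfl (h0.trans_lt ht)
  rw [← hγ.flow_eq hD hL h0 ht, ← hη.flow_eq hD hL h0 ht]
  exact hmono y hy x hx hxy t h0
    (lt_min (hη.lt_exitTime hD hL h0 ht hη.mem) (hγ.lt_exitTime hD hL h0 ht hγ.mem))

theorem IsForcedSolutionOn.exists_add_exp_smul {K : ℝ≥0} {x u : X} {r δ ε Λ : ℝ}
    (hball : closedBall x r ⊆ D) (hK : LipschitzOnWith K φ (closedBall x r)) (hδ : 0 < δ)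
    (hu : closedBall u δ ⊆ (C : Set X)) (hΛ : K * ‖u‖ < Λ * δ) (hε : 0 < ε)
    (hεr : ε * Real.exp (Λ * (T - s)) * ‖u‖ ≤ r / 2) (hb : IsForcedSolutionOn φ D q s T b)
    (hbx : ∀ t ∈ Ico s T, b t ∈ closedBall x (r / 2)) :
    ∃ q' : ℝ → X,
      IsForcedSolutionOn φ D q' s T (fun t => b t + (ε * Real.exp (Λ * (t - s))) • u) ∧
      ∀ t ∈ Ico s T, Ll C (q t) (q' t) := by
  have hΛ0 : 0 < Λ := pos_of_mul_pos_left ((by positivity : (0 : ℝ) ≤ K * ‖u‖).trans_lt hΛ) hδ.le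
  let θ : ℝ → ℝ := fun t => ε * Real.exp (Λ * (t - s))
  have hθ : ∀ t, 0 < θ t := fun t => by positivity
  have hr : 0 ≤ r / 2 := le_trans (by positivity) hεr
  have hbθ : ∀ t ∈ Ico s T, b t + θ t • u ∈ closedBall x r := by
    intro t ht
    have hsmall : ‖θ t • u‖ ≤ r / 2 := by
      rw [norm_smul, Real.norm_of_nonneg (hθ t).le]
      refine le_trans ?_ hεr
      simp only [θ]
      gcongr
      exact ht.2.le
    rw [mem_closedBall_iff_norm, add_sub_right_comm]
    linarith [norm_add_le (b t - x) (θ t • u), mem_closedBall_iff_norm.1 (hbx t ht)]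
  refine ⟨fun t => q t + (Λ * θ t) • u + (φ (b t) - φ (b t + θ t • u)),
    ⟨hb.continuousOn.add (by fun_prop), fun t ht => hball (hbθ t ht), fun t ht => ?_⟩,
    fun t ht => ?_⟩
  · have hderiv : HasDerivAt θ (Λ * θ t) t :=
      ((((hasDerivAt_id t).sub_const s).const_mul Λ).exp.const_mul ε).congr_deriv (by
        simp only [θ, id]; ring)
    exact ((hb.deriv t ht).add (hderiv.smul_const u).hasDerivWithinAt).congr_deriv (by abel)
  · have hlip : ‖φ (b t) - φ (b t + θ t • u)‖ ≤ K * (θ t * ‖u‖) := by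
      have := hK.norm_sub_le (closedBall_subset_closedBall (by linarith) (hbx t ht)) (hbθ t ht)
      rwa [sub_add_cancel_left, norm_neg, norm_smul, Real.norm_of_nonneg (hθ t).le] at this
    simp only [Ll]
    rw [add_assoc, add_sub_cancel_left]
    exact smul_add_mem_interior hδ hu (by nlinarith [hθ t])

variable [CompleteSpace X]

theorem OrderPreservingOn.eventually_le_of_ll (hmono : OrderPreservingOn C φ D D)
    (hD : IsOpen D) (hL : LocallyLipschitzOn D φ) {u v : X} (hat : a t ∈ D) (hbt : b t ∈ D)
    (ha : HasDerivWithinAt a (φ (a t) + u) (Ici t) t)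
    (hb : HasDerivWithinAt b (φ (b t) + v) (Ici t) t) (huv : Ll C u v)
    (hab : Le C (a t) (b t)) : ∀ᶠ r in 𝓝[>] t, Le C (a r) (b r) := by
  obtain ⟨c, hc, γ, hγ⟩ := exists_isSolution hD hL hat
  obtain ⟨d, hd, η, hη⟩ := exists_isSolution hD hL hbt
  have hderiv : HasDerivWithinAt (fun r => (b r - η (r - t)) - (a r - γ (r - t))) (v - u)
      (Ici t) t := by
    have := (hb.sub (hη.hasDerivWithinAt_comp_sub hd t)).sub
      (ha.sub (hγ.hasDerivWithinAt_comp_sub hc t))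
    rwa [add_sub_cancel_left, add_sub_cancel_left] at this
  have hlt : ∀ᶠ r in 𝓝[>] t, r < t + min c d :=
    mem_nhdsWithin_of_mem_nhds (Iio_mem_nhds (by linarith [lt_min hc hd]))
  filter_upwards [eventually_sub_mem_of_hasDerivWithinAt hderiv huv, hlt, self_mem_nhdsWithin]
    with r hr hrlt (htr : t < r)
  have hflow : Le C (γ (r - t)) (η (r - t)) :=
    hmono.le_of_isSolution hD hL (hγ.mono (min_le_left c d)) (hη.mono (min_le_right c d)) hab
      (by linarith) (by linarith)
  simp only [sub_self, hγ.initial, hη.initial, sub_zero] at hr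
  have hsum : b r - η (r - t) - (a r - γ (r - t)) + (η (r - t) - γ (r - t)) ∈ C :=
    add_mem (S := Submodule _ X) hr hflow
  rwa [show b r - η (r - t) - (a r - γ (r - t)) + (η (r - t) - γ (r - t)) = b r - a r by abel]
    at hsum

theorem IsForcedSolutionOn.le_of_forall_ll (hmono : OrderPreservingOn C φ D D) (hD : IsOpen D)
    (hL : LocallyLipschitzOn D φ) (ha : IsForcedSolutionOn φ D p s T a)
    (hb : IsForcedSolutionOn φ D q s T b) (hpq : ∀ t ∈ Ico s T, Ll C (p t) (q t))
    (hab : Le C (a s) (b s)) : ∀ t ∈ Icc s T, Le C (a t) (b t) :=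
  (isClosed_setOf_le_inter_Icc ha.continuousOn hb.continuousOn).Icc_subset_of_forall_mem_nhdsWithin
    hab fun t ht => hmono.eventually_le_of_ll hD hL (ha.mem t ht.2) (hb.mem t ht.2)
      (ha.deriv t ht.2) (hb.deriv t ht.2) (hpq t ht.2) ht.1

theorem IsForcedSolutionOn.eventually_le (hmono : OrderPreservingOn C φ D D) (hD : IsOpen D)
    (hL : LocallyLipschitzOn D φ) (hC : (interior (C : Set X)).Nonempty)
    (ha : IsForcedSolutionOn φ D p s T a) (hb : IsForcedSolutionOn φ D q s T b)
    (hpq : ∀ t ∈ Ico s T, Le C (p t) (q t)) (ht : t ∈ Ico s T) (hab : Le C (a t) (b t)) :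
    ∀ᶠ w in 𝓝[>] t, Le C (a w) (b w) := by
  obtain ⟨u, hu⟩ := hC
  obtain ⟨δ, hδ, hball⟩ := exists_closedBall_subset hu
  obtain ⟨K, r, hr, hrD, hK⟩ := exists_closedBall_lipschitzOnWith hD hL (hb.mem t ht)
  obtain ⟨Λ, hΛ⟩ := exists_gt (K * ‖u‖ / δ)
  rw [div_lt_iff₀ hδ] at hΛ
  have hnear : ∀ᶠ w in 𝓝[≥] t, b w ∈ closedBall (b t) (r / 2) ∧ w < T :=
    ((hb.deriv t ht).continuousWithinAt.eventually (closedBall_mem_nhds _ (half_pos hr))).and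
      (mem_nhdsWithin_of_mem_nhds (Iio_mem_nhds ht.2))
  obtain ⟨w₀, htw₀, hw₀⟩ := mem_nhdsGE_iff_exists_Icc_subset.1 hnear
  filter_upwards [Icc_mem_nhdsGT htw₀] with w hw
  let E : ℝ := Real.exp (Λ * (w - t))
  have hsmall : ∀ᶠ ε in 𝓝[>] (0 : ℝ), ε * E * ‖u‖ ≤ r / 2 := by
    have hcont : Continuous fun ε : ℝ => ε * E * ‖u‖ := by fun_prop
    exact (hcont.tendsto' 0 0 (by simp)).mono_left nhdsWithin_le_nhds |>.eventually
      (Iic_mem_nhds (half_pos hr))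
  have hperturbed : ∀ᶠ ε in 𝓝[>] (0 : ℝ), b w + (ε * E) • u - a w ∈ C := by
    filter_upwards [hsmall, self_mem_nhdsWithin] with ε hεr (hε : 0 < ε)
    have hTw : w ≤ T := (hw₀ hw).2.le
    obtain ⟨q', hb', hq'⟩ := (hb.mono ht.1 hTw).exists_add_exp_smul hrD hK hδ hball hΛ hε hεr
      fun r hr => (hw₀ ⟨hr.1, hr.2.le.trans hw.2⟩).1
    refine (ha.mono ht.1 hTw).le_of_forall_ll hmono hD hL hb' (fun r hr => ?_) ?_ w ⟨hw.1, le_rfl⟩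
    · rw [Ll, ← sub_add_sub_cancel (q' r) (q r)]
      exact add_mem_interior (hq' r hr) (hpq r ⟨ht.1.trans hr.1, hr.2.trans_le hTw⟩)
    · refine hab.trans ?_
      rw [Le, add_sub_cancel_left]
      exact C.smul_mem (interior_subset hu) (by positivity)
  have hlim : Continuous fun ε : ℝ => b w + (ε * E) • u - a w := by fun_prop
  exact C.isClosed.mem_of_tendsto
    ((hlim.tendsto' 0 (b w - a w) (by simp)).mono_left nhdsWithin_le_nhds) hperturbed

theorem IsForcedSolutionOn.le (hmono : OrderPreservingOn C φ D D) (hD : IsOpen D)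
    (hL : LocallyLipschitzOn D φ) (hC : (interior (C : Set X)).Nonempty)
    (ha : IsForcedSolutionOn φ D p s T a) (hb : IsForcedSolutionOn φ D q s T b)
    (hpq : ∀ t ∈ Ico s T, Le C (p t) (q t)) (hab : Le C (a s) (b s)) :
    ∀ t ∈ Icc s T, Le C (a t) (b t) :=
  (isClosed_setOf_le_inter_Icc ha.continuousOn hb.continuousOn).Icc_subset_of_forall_mem_nhdsWithin
    hab fun _ ht => ha.eventually_le hmono hD hL hC hb hpq ht.2 ht.1

end Comparison

section RadialCurves

variable {X : Type*} [NormedAddCommGroup X] [NormedSpace ℝ X] {C : ProperCone ℝ X} {φ : X → X}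
  {e x : X} {α β c ρ μ b t : ℝ} {γ : ℝ → X}

/-- The curve on the ray of `e` whose signed logarithmic distance to `e` is `c` at time `0` and
decays at the rate `α`. -/
noncomputable def radialCurve (e : X) (α c t : ℝ) : X :=
  Real.exp (Real.exp (-α * t) * c) • e

/-- The forcing that has to be added to `φ` at the point `exp c • e` for `radialCurve e α` to be a
solution. -/
noncomputable def radialDefect (φ : X → X) (e : X) (α c : ℝ) : X :=
  -(α * (Real.exp c * c)) • e - φ (Real.exp c • e)

/-- The radial curves of rate `α` at distance at most `ρ` from `e` are supersolutions above `e` and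
subsolutions below `e`. The factor `c` encodes the change of sign at `e`. -/
def RadialBound (C : ProperCone ℝ X) (φ : X → X) (e : X) (ρ α : ℝ) : Prop :=
  ∀ c : ℝ, |c| ≤ ρ → c • radialDefect φ e α c ∈ C

/-- The numbers whose infimum is the best rate: the values of `m((-(l ln l)⁻¹ φ(l e)) / e)` for
`μ⁻¹ < l < μ` and `l ≠ 1`. -/
def radialRatios (C : ProperCone ℝ X) (φ : X → X) (e : X) (μ : ℝ) : Set ℝ :=
  {r : ℝ | ∃ l : ℝ, μ⁻¹ < l ∧ l < μ ∧ l ≠ 1 ∧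
    r = lowerRatio C (-(l * Real.log l)⁻¹ • φ (l • e)) e}

/-- Every trajectory issued from `U` approaches `e` in the part metric with rate at least `β`, until
it leaves `U`. -/
def ContractsAtRate (C : ProperCone ℝ X) (φ : X → X) (e : X) (U : Set X) (β : ℝ) : Prop :=
  ∀ x ∈ U, ∀ t : ℝ, 0 ≤ t → (t : EReal) < exitTime φ (interior (C : Set X)) U x →
    dT C (flow φ (interior (C : Set X)) t x) e ≤ Real.exp (-β * t) * dT C x e

theorem radialCurve_zero : radialCurve e α c 0 = Real.exp c • e := by
  simp [radialCurve]

theorem radialCurve_mem_interior (he : e ∈ interior (C : Set X)) :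
    radialCurve e α c t ∈ interior (C : Set X) :=
  smul_mem_interior (Real.exp_pos _) he

theorem hasDerivAt_radialCurve (φ : X → X) : HasDerivAt (radialCurve e α c)
    (φ (radialCurve e α c t) + radialDefect φ e α (Real.exp (-α * t) * c)) t := by
  have hexponent : HasDerivAt (fun s => Real.exp (-α * s) * c) (-α * (Real.exp (-α * t) * c)) t :=
    ((((hasDerivAt_id t).const_mul (-α)).exp).mul_const c).congr_deriv (by simp only [id]; ring)
  refine (hexponent.exp.smul_const e).congr_deriv ?_
  rw [radialCurve, radialDefect, add_sub_cancel]
  congr 1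
  ring

theorem isForcedSolutionOn_radialCurve (φ : X → X) (he : e ∈ interior (C : Set X)) (T : ℝ) :
    IsForcedSolutionOn φ (interior (C : Set X))
      (fun t => radialDefect φ e α (Real.exp (-α * t) * c)) 0 T (radialCurve e α c) where
  continuousOn _ _ := (hasDerivAt_radialCurve φ).continuousAt.continuousWithinAt
  mem _ _ := radialCurve_mem_interior he
  deriv _ _ := (hasDerivAt_radialCurve φ).hasDerivWithinAt

theorem radialDefect_zero (hzero : φ e = 0) : radialDefect φ e α 0 = 0 := by
  simp [radialDefect, hzero]

theorem RadialBound.radialDefect_mem (hφ : RadialBound C φ e ρ α) (hzero : φ e = 0)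
    (h0 : 0 ≤ c) (hc : |c| ≤ ρ) : radialDefect φ e α c ∈ C := by
  rcases h0.eq_or_lt with rfl | hpos
  · simp [radialDefect_zero hzero]
  · exact (C.toPointedCone.smul_mem_iff hpos).1 (hφ c hc)

theorem RadialBound.neg_radialDefect_mem (hφ : RadialBound C φ e ρ α) (hzero : φ e = 0)
    (h0 : c ≤ 0) (hc : |c| ≤ ρ) : -radialDefect φ e α c ∈ C := by
  rcases h0.eq_or_lt with rfl | hneg
  · simp [radialDefect_zero hzero]
  · refine (C.toPointedCone.smul_mem_iff (neg_pos.2 hneg)).1 ?_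
    rw [neg_smul_neg]
    exact hφ c hc

theorem exp_mul_le_of_mem_Icc {d s : ℝ} (hd : 0 ≤ d) (hρ : d ≤ ρ)
    (ht : Real.exp (-α * t) * d ≤ ρ) (hs : s ∈ Icc 0 t) : Real.exp (-α * s) * d ≤ ρ := by
  rcases le_total 0 α with hα | hα
  · have hle : Real.exp (-α * s) ≤ 1 := Real.exp_le_one_iff.2 (by nlinarith [hs.1])
    exact (mul_le_of_le_one_left hd hle).trans hρ
  · have hle : Real.exp (-α * s) ≤ Real.exp (-α * t) := Real.exp_le_exp.2 (by nlinarith [hs.2])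
    exact (mul_le_mul_of_nonneg_right hle hd).trans ht

theorem RadialBound.dT_le [CompleteSpace X] (hφ : RadialBound C φ e ρ α)
    (h0 : (0 : X) ∉ interior (C : Set X))
    (hmono : OrderPreservingOn C φ (interior (C : Set X)) (interior (C : Set X)))
    (hL : LocallyLipschitzOn (interior (C : Set X)) φ) (he : e ∈ interior (C : Set X))
    (hzero : φ e = 0) (hγ : IsSolution φ (interior (C : Set X)) x b γ) (ht : 0 ≤ t) (htb : t < b)
    (hx : dT C x e ≤ ρ) (hxt : Real.exp (-α * t) * dT C x e ≤ ρ) :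
    dT C (γ t) e ≤ Real.exp (-α * t) * dT C x e := by
  have hxC : x ∈ interior (C : Set X) := hγ.initial ▸ hγ.mem 0 le_rfl (ht.trans_lt htb)
  have hd := dT_nonneg h0 hxC he
  obtain ⟨hle, hge⟩ := (dT_le_iff h0 hxC he).1 le_rfl
  have hsol := hγ.isForcedSolutionOn htb
  have hcurve : ∀ c, IsForcedSolutionOn φ (interior (C : Set X)) _ 0 t (radialCurve e α c) :=
    fun c => isForcedSolutionOn_radialCurve φ he t
  have hρ : ∀ s ∈ Ico 0 t, Real.exp (-α * s) * dT C x e ≤ ρ :=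
    fun s hs => exp_mul_le_of_mem_Icc hd hx hxt ⟨hs.1, hs.2.le⟩
  rw [dT_le_iff h0 (hγ.mem t ht htb) he, ← mul_neg]
  constructor
  · refine hsol.le hmono isOpen_interior hL ⟨e, he⟩ (hcurve (dT C x e)) (fun s hs => ?_) ?_ t
      ⟨ht, le_rfl⟩
    · rw [Le, sub_zero]
      exact hφ.radialDefect_mem hzero (by positivity)
        ((abs_of_nonneg (by positivity)).trans_le (hρ s hs))
    · rwa [radialCurve_zero, hγ.initial]
  · refine (hcurve (-dT C x e)).le hmono isOpen_interior hL ⟨e, he⟩ hsol (fun s hs => ?_) ?_ t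
      ⟨ht, le_rfl⟩
    · rw [Le, zero_sub, mul_neg]
      exact hφ.neg_radialDefect_mem hzero (neg_nonpos.2 (by positivity))
        ((abs_neg _).trans_le ((abs_of_nonneg (by positivity)).trans_le (hρ s hs)))
    · rwa [radialCurve_zero, hγ.initial]

theorem smul_radialDefect_mem_of_dT_le (h0 : (0 : X) ∉ interior (C : Set X))
    (he : e ∈ interior (C : Set X)) (hb : 0 < b)
    (hγ : IsSolution φ (interior (C : Set X)) (Real.exp c • e) b γ)
    (h : ∀ t, 0 ≤ t → t < b → dT C (γ t) e ≤ Real.exp (-β * t) * |c|) :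
    c • radialDefect φ e β c ∈ C := by
  have hderiv : HasDerivWithinAt (fun t => c • (radialCurve e β c t - γ t))
      (c • radialDefect φ e β c) (Ici 0) 0 := by
    refine (((hasDerivAt_radialCurve φ).hasDerivWithinAt.sub
      (hγ.deriv 0 le_rfl hb)).const_smul c).congr_deriv ?_
    simp [radialCurve_zero, hγ.initial]
  refine mem_of_hasDerivWithinAt hderiv ?_
  filter_upwards [Ioo_mem_nhdsGT hb] with t ht
  have hmem := smul_exp_smul_sub_mem (c := Real.exp (-β * t) * c) h0 (hγ.mem t ht.1.le ht.2) he
    (by simpa [abs_mul] using h t ht.1.le ht.2)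
  rw [mul_smul, ← radialCurve] at hmem
  simpa [radialCurve_zero, hγ.initial] using
    (C.toPointedCone.smul_mem_iff (Real.exp_pos (-β * t))).1 hmem

theorem le_lowerRatio_iff_smul_radialDefect_mem (h0 : (0 : X) ∉ interior (C : Set X))
    (he : e ∈ interior (C : Set X)) (hc : c ≠ 0) :
    α ≤ lowerRatio C (-(Real.exp c * c)⁻¹ • φ (Real.exp c • e)) e ↔
      c • radialDefect φ e α c ∈ C := by
  have hpos : 0 < Real.exp c * (c * c) := mul_pos (Real.exp_pos c) (mul_self_pos.2 hc)
  have hscale : (Real.exp c * (c * c)) • (-(Real.exp c * c)⁻¹ • φ (Real.exp c • e) - α • e) =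
      c • radialDefect φ e α c := by
    have hcancel : Real.exp c * (c * c) * -(Real.exp c * c)⁻¹ = -c := by field_simp
    rw [radialDefect, smul_sub, smul_sub, smul_smul, smul_smul, smul_smul, hcancel]
    module
  rw [le_lowerRatio_iff h0 he, ← hscale]
  exact (C.toPointedCone.smul_mem_iff hpos).symm

theorem continuous_smul_radialDefect (hφ : ContinuousOn φ (interior (C : Set X)))
    (he : e ∈ interior (C : Set X)) : Continuous fun c => c • radialDefect φ e α c := by
  have hray : Continuous fun c : ℝ => φ (Real.exp c • e) :=
    hφ.comp_continuous (by fun_prop) fun c => smul_mem_interior (Real.exp_pos c) he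
  exact continuous_id.smul (.sub (by fun_prop) hray)

theorem radialBound_iff_forall_abs_lt (hφ : ContinuousOn φ (interior (C : Set X)))
    (he : e ∈ interior (C : Set X)) (hρ : 0 < ρ) :
    RadialBound C φ e ρ α ↔ ∀ c : ℝ, |c| < ρ → c • radialDefect φ e α c ∈ C := by
  refine ⟨fun h c hc => h c hc.le, fun h c hc => ?_⟩
  have hmaps : MapsTo (fun c => c • radialDefect φ e α c) (ball 0 ρ) C :=
    fun c hc => h c (mem_ball_zero_iff.1 hc)
  have hclosure := hmaps.closure (continuous_smul_radialDefect hφ he)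
  rw [closure_ball _ hρ.ne', C.isClosed.closure_eq] at hclosure
  exact hclosure (mem_closedBall_zero_iff.2 hc)

theorem radialBound_log_iff_mem_lowerBounds (h0 : (0 : X) ∉ interior (C : Set X))
    (hφ : ContinuousOn φ (interior (C : Set X))) (he : e ∈ interior (C : Set X)) (hμ : 1 < μ) :
    RadialBound C φ e (Real.log μ) α ↔ α ∈ lowerBounds (radialRatios C φ e μ) := by
  have hμ0 : 0 < μ := one_pos.trans hμ
  rw [radialBound_iff_forall_abs_lt hφ he (Real.log_pos hμ)]
  constructor
  · rintro h _ ⟨l, hl, hlμ, hl1, rfl⟩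
    have hl0 : 0 < l := (inv_pos.2 hμ0).trans hl
    have hlog : |Real.log l| < Real.log μ :=
      abs_lt.2 ⟨Real.log_inv μ ▸ Real.log_lt_log (inv_pos.2 hμ0) hl, Real.log_lt_log hl0 hlμ⟩
    have hratio := (le_lowerRatio_iff_smul_radialDefect_mem h0 he
      (Real.log_ne_zero_of_pos_of_ne_one hl0 hl1)).2 (h _ hlog)
    rwa [Real.exp_log hl0] at hratio
  · intro h c hc
    rcases eq_or_ne c 0 with rfl | hc0
    · simp
    · refine (le_lowerRatio_iff_smul_radialDefect_mem h0 he hc0).1 (h ⟨Real.exp c, ?_, ?_, ?_, ?_⟩)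
      · rw [← Real.exp_log hμ0, ← Real.exp_neg]
        exact Real.exp_lt_exp.2 (abs_lt.1 hc).1
      · exact (Real.lt_log_iff_exp_lt hμ0).1 (abs_lt.1 hc).2
      · exact (Real.exp_eq_one_iff c).not.2 hc0
      · rw [Real.log_exp]

theorem abs_exp_sub_one_le_mul_exp (hc : |c| ≤ ρ) :
    |Real.exp c - 1| ≤ |c| * Real.exp c * Real.exp ρ := by
  have hneg : |1 - Real.exp (-c)| ≤ |c| * Real.exp ρ := by
    rcases le_total 0 c with h0 | h0
    · rw [abs_of_nonneg h0] at hc ⊢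
      rw [abs_of_nonneg (sub_nonneg.2 (Real.exp_le_one_iff.2 (neg_nonpos.2 h0)))]
      have hone : 1 ≤ Real.exp ρ := Real.one_le_exp (h0.trans hc)
      nlinarith [Real.add_one_le_exp (-c)]
    · rw [abs_of_nonpos h0] at hc ⊢
      rw [abs_of_nonpos (sub_nonpos.2 (Real.one_le_exp (neg_nonneg.2 h0)))]
      have hcancel : Real.exp c * Real.exp (-c) = 1 := by rw [← Real.exp_add]; simp
      nlinarith [Real.add_one_le_exp c, Real.exp_le_exp.2 hc, Real.exp_pos (-c)]
  calc |Real.exp c - 1| = Real.exp c * |1 - Real.exp (-c)| := by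
        rw [← abs_of_pos (Real.exp_pos c), ← abs_mul, abs_of_pos (Real.exp_pos c), mul_sub,
          ← Real.exp_add]
        simp
    _ ≤ Real.exp c * (|c| * Real.exp ρ) := by gcongr
    _ = |c| * Real.exp c * Real.exp ρ := by ring

theorem exists_radialBound (hL : LocallyLipschitzOn (interior (C : Set X)) φ)
    (he : e ∈ interior (C : Set X)) (hzero : φ e = 0) (hρ : 0 ≤ ρ) :
    ∃ α, RadialBound C φ e ρ α := by
  obtain ⟨δ, hδ, hball⟩ := exists_closedBall_subset he
  have hcompact : IsCompact ((fun c => Real.exp c • e) '' Icc (-ρ) ρ) :=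
    isCompact_Icc.image (by fun_prop)
  have hsub : (fun c => Real.exp c • e) '' Icc (-ρ) ρ ⊆ interior (C : Set X) :=
    image_subset_iff.2 fun c _ => smul_mem_interior (Real.exp_pos c) he
  obtain ⟨K, hK⟩ := (hL.mono hsub).exists_lipschitzOnWith_of_compact hcompact
  have hφ : ∀ c : ℝ, |c| ≤ ρ → ‖φ (Real.exp c • e)‖ ≤ K * (|Real.exp c - 1| * ‖e‖) := by
    intro c hc
    have hlip := hK.norm_sub_le (mem_image_of_mem _ (abs_le.1 hc))
      (mem_image_of_mem _ (show (0 : ℝ) ∈ Icc (-ρ) ρ from ⟨by linarith, hρ⟩))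
    simp only [Real.exp_zero] at hlip
    rwa [← sub_smul, one_smul, hzero, sub_zero, norm_smul, Real.norm_eq_abs] at hlip
  refine ⟨-(K * ‖e‖ * Real.exp ρ / δ), fun c hc => ?_⟩
  have hexp := abs_exp_sub_one_le_mul_exp hc
  have hmem : ((K * ‖e‖ * Real.exp ρ / δ) * (Real.exp c * (c * c))) • e +
      -(c • φ (Real.exp c • e)) ∈ C := by
    refine smul_add_mem hδ hball ?_
    calc ‖-(c • φ (Real.exp c • e))‖ = |c| * ‖φ (Real.exp c • e)‖ := by
          rw [norm_neg, norm_smul, Real.norm_eq_abs]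
      _ ≤ |c| * (K * (|c| * Real.exp c * Real.exp ρ * ‖e‖)) := by
          gcongr
          exact (hφ c hc).trans (by gcongr)
      _ = K * ‖e‖ * Real.exp ρ / δ * (Real.exp c * (c * c)) * δ := by
          rw [← abs_mul_abs_self c]
          field_simp
  convert hmem using 1
  rw [radialDefect]
  module

theorem radialRatios_nonempty (hμ : 1 < μ) : (radialRatios C φ e μ).Nonempty := by
  obtain ⟨l, hl, hlμ⟩ := exists_between hμ
  exact ⟨_, l, (inv_lt_one_of_one_lt₀ hμ).trans hl, hlμ, hl.ne', rfl⟩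

theorem isOpen_openInterval {x y : X} : IsOpen (openInterval C x y) :=
  (isOpen_interior.preimage (by fun_prop)).inter (isOpen_interior.preimage (by fun_prop))

theorem exp_smul_mem_openInterval (he : e ∈ interior (C : Set X)) (hμ : 0 < μ)
    (hc : |c| < Real.log μ) : Real.exp c • e ∈ openInterval C (μ⁻¹ • e) (μ • e) := by
  rw [← Real.exp_log hμ, ← Real.exp_neg]
  exact ⟨smul_ll_smul_right (Real.exp_lt_exp.2 (abs_lt.1 hc).1) he,
    smul_ll_smul_right (Real.exp_lt_exp.2 (abs_lt.1 hc).2) he⟩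

theorem RadialBound.contractsAtRate [CompleteSpace X] (h0 : (0 : X) ∉ interior (C : Set X))
    (hmono : OrderPreservingOn C φ (interior (C : Set X)) (interior (C : Set X)))
    (hL : LocallyLipschitzOn (interior (C : Set X)) φ) (he : e ∈ interior (C : Set X))
    (hzero : φ e = 0) (hμ : 0 < μ) (hφ : RadialBound C φ e (Real.log μ) β) :
    ContractsAtRate C φ e (openInterval C (μ⁻¹ • e) (μ • e)) β := by
  have hlog : ∀ z ∈ openInterval C (μ⁻¹ • e) (μ • e), dT C z e ≤ Real.log μ := fun z hz =>
    have hz' := openInterval_subset_closedInterval hz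
    (mem_closedInterval_iff_dT_le h0
      (closedInterval_subset_interior (smul_mem_interior (inv_pos.2 hμ) he) hz') he hμ).1 hz'
  intro x hx t ht hexit
  obtain ⟨b, htb, γ, hγ, hγU⟩ := exists_isSolution_of_lt_exitTime isOpen_interior hL hexit
  rw [hγ.flow_eq isOpen_interior hL ht htb]
  rcases le_total (Real.exp (-β * t) * dT C x e) (Real.log μ) with h | h
  · exact hφ.dT_le h0 hmono hL he hzero hγ ht htb (hlog x hx) h
  · exact (hlog _ (hγU t ht htb)).trans h

theorem ContractsAtRate.smul_radialDefect_mem [CompleteSpace X] {U : Set X}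
    (hβ : ContractsAtRate C φ e U β)
    (h0 : (0 : X) ∉ interior (C : Set X)) (hL : LocallyLipschitzOn (interior (C : Set X)) φ)
    (he : e ∈ interior (C : Set X)) (hU : IsOpen U) (hc : Real.exp c • e ∈ U) :
    c • radialDefect φ e β c ∈ C := by
  obtain ⟨b, hb, γ, hγ⟩ := exists_isSolution isOpen_interior hL
    (smul_mem_interior (Real.exp_pos c) he)
  have hstay : ∀ᶠ t in 𝓝[≥] (0 : ℝ), γ t ∈ U :=
    (hγ.deriv 0 le_rfl hb).continuousWithinAt.eventually (hU.mem_nhds (hγ.initial.symm ▸ hc))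
  obtain ⟨w, hw : 0 < w, hwU⟩ := mem_nhdsGE_iff_exists_Icc_subset.1 hstay
  have hγw := hγ.mono (min_le_left b w)
  refine smul_radialDefect_mem_of_dT_le h0 he (lt_min hb hw) hγw fun t ht htb => ?_
  have hexit := hγw.lt_exitTime isOpen_interior hL ht htb fun s hs hsb =>
    hwU ⟨hs, hsb.le.trans (min_le_right b w)⟩
  rw [← hγw.flow_eq isOpen_interior hL ht htb]
  exact (hβ _ hc t ht hexit).trans (by gcongr; exact dT_exp_smul_self_le h0 he c)

theorem contractsAtRate_iff_radialBound [CompleteSpace X] (h0 : (0 : X) ∉ interior (C : Set X))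
    (hmono : OrderPreservingOn C φ (interior (C : Set X)) (interior (C : Set X)))
    (hL : LocallyLipschitzOn (interior (C : Set X)) φ) (he : e ∈ interior (C : Set X))
    (hzero : φ e = 0) (hμ : 1 < μ) :
    ContractsAtRate C φ e (openInterval C (μ⁻¹ • e) (μ • e)) β ↔
      RadialBound C φ e (Real.log μ) β := by
  have hμ0 : 0 < μ := one_pos.trans hμ
  refine ⟨fun hβ => ?_, fun hβ => hβ.contractsAtRate h0 hmono hL he hzero hμ0⟩
  rw [radialBound_iff_forall_abs_lt hL.continuousOn he (Real.log_pos hμ)]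
  exact fun c hc => hβ.smul_radialDefect_mem h0 hL he isOpen_openInterval
    (exp_smul_mem_openInterval he hμ0 hc)

end RadialCurves

section NormalCone

variable {X : Type*} [NormedAddCommGroup X] [NormedSpace ℝ X] {C : ProperCone ℝ X} {φ : X → X}
  {e p q x : X} {α μ : ℝ}

theorem convex_setOf_le : Convex ℝ {z | Le C x z} := by
  simp only [Le, sub_eq_add_neg]
  exact C.toPointedCone.convex.translate_preimage_left (-x)

theorem isClosed_setOf_le : IsClosed {z | Le C x z} :=
  C.isClosed.preimage (by fun_prop)

theorem le_inv_two_smul_of_norm_sub_le {δ : ℝ} {z w : X}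
    (hball : closedBall ((2 : ℝ)⁻¹ • p) δ ⊆ (C : Set X)) (hz : Le C p z) (hw : ‖w - z‖ ≤ δ) :
    Le C ((2 : ℝ)⁻¹ • p) w := by
  have hmem : (2 : ℝ)⁻¹ • p + (w - z) ∈ C := hball (by simpa using hw)
  have hsum := add_mem (S := Submodule _ X) hz hmem
  rwa [show z - p + ((2 : ℝ)⁻¹ • p + (w - z)) = w - (2 : ℝ)⁻¹ • p by module] at hsum

theorem IsNormal.exists_forall_closedBall_subset (hC : IsNormal C) (hp : p ∈ interior (C : Set X))
    (q : X) : ∃ δ > 0, ∃ S ⊆ interior (C : Set X), IsClosed S ∧ Bornology.IsBounded S ∧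
      Convex ℝ S ∧ ∀ z ∈ closedInterval C p q, closedBall z δ ⊆ S := by
  obtain ⟨N, hN⟩ := hC
  have hhalf : (2 : ℝ)⁻¹ • p ∈ interior (C : Set X) := smul_mem_interior (by norm_num) hp
  obtain ⟨δ, hδ, hball⟩ := exists_closedBall_subset hhalf
  refine ⟨δ, hδ, {z | Le C ((2 : ℝ)⁻¹ • p) z} ∩ closedBall 0 (N * ‖q‖ + δ),
    fun z hz => mem_interior_of_le hhalf hz.1, isClosed_setOf_le.inter isClosed_closedBall,
    isBounded_closedBall.subset inter_subset_right, convex_setOf_le.inter (convex_closedBall _ _),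
    fun z hz w hw => ?_⟩
  rw [mem_closedBall_iff_norm] at hw
  have hzpos : Le C 0 z := by
    rw [Le, sub_zero]
    exact interior_subset (mem_interior_of_le hp hz.1)
  refine ⟨le_inv_two_smul_of_norm_sub_le hball hz.1 hw, mem_closedBall_zero_iff.2 ?_⟩
  linarith [hN z q hzpos hz.2, norm_le_norm_sub_add w z]

theorem IsNormal.exists_forall_isSolution [CompleteSpace X] (hC : IsNormal C)
    (hφ : LipschitzOnBoundedConvex φ (interior (C : Set X))) (hp : p ∈ interior (C : Set X))
    (q : X) : ∃ τ : ℝ, 0 < τ ∧ ∀ z ∈ closedInterval C p q,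
      ∃ γ : ℝ → X, IsSolution φ (interior (C : Set X)) z τ γ := by
  obtain ⟨δ, hδ, S, hSC, hclosed, hbdd, hconv, hball⟩ := hC.exists_forall_closedBall_subset hp q
  obtain ⟨K, hK⟩ := hφ S hSC hclosed hbdd hconv
  obtain ⟨τ, hτ, hsol⟩ := exists_forall_isSolution_of_closedBall_subset hK hbdd hSC hδ
  exact ⟨τ, hτ, fun z hz => hsol z (hball z hz)⟩

theorem RadialBound.dT_le_of_nonneg [CompleteSpace X] {ρ b t : ℝ} {γ : ℝ → X}
    (hα : RadialBound C φ e ρ α) (h0 : (0 : X) ∉ interior (C : Set X))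
    (hmono : OrderPreservingOn C φ (interior (C : Set X)) (interior (C : Set X)))
    (hL : LocallyLipschitzOn (interior (C : Set X)) φ) (he : e ∈ interior (C : Set X))
    (hzero : φ e = 0) (hα0 : 0 ≤ α) (hγ : IsSolution φ (interior (C : Set X)) x b γ)
    (ht : 0 ≤ t) (htb : t < b) (hx : dT C x e ≤ ρ) :
    dT C (γ t) e ≤ Real.exp (-α * t) * dT C x e ∧ dT C (γ t) e ≤ ρ := by
  have hxC : x ∈ interior (C : Set X) := hγ.initial ▸ hγ.mem 0 le_rfl (ht.trans_lt htb)
  have hexp : Real.exp (-α * t) ≤ 1 := Real.exp_le_one_iff.2 (by nlinarith)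
  have hle := (mul_le_of_le_one_left (dT_nonneg h0 hxC he) hexp).trans hx
  have hdT := hα.dT_le h0 hmono hL he hzero hγ ht htb hx hle
  exact ⟨hdT, hdT.trans hle⟩

theorem RadialBound.dT_flow_le_of_nonneg [CompleteSpace X] {ρ : ℝ}
    (hα : RadialBound C φ e ρ α) (h0 : (0 : X) ∉ interior (C : Set X))
    (hmono : OrderPreservingOn C φ (interior (C : Set X)) (interior (C : Set X)))
    (hL : LocallyLipschitzOn (interior (C : Set X)) φ) (he : e ∈ interior (C : Set X))
    (hzero : φ e = 0) (hα0 : 0 ≤ α) (hx : dT C x e ≤ ρ) {t : ℝ} (ht : 0 ≤ t)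
    (hlt : (t : EReal) < existenceTime φ (interior (C : Set X)) x) :
    dT C (flow φ (interior (C : Set X)) t x) e ≤ Real.exp (-α * t) * dT C x e := by
  obtain ⟨b, htb, γ, hγ⟩ := exists_isSolution_of_lt_existenceTime hlt
  rw [hγ.flow_eq isOpen_interior hL ht htb]
  exact (hα.dT_le_of_nonneg h0 hmono hL he hzero hα0 hγ ht htb hx).1

theorem IsNormal.existenceTime_eq_top [CompleteSpace X] (hC : IsNormal C)
    (hφ : LipschitzOnBoundedConvex φ (interior (C : Set X)))
    (h0 : (0 : X) ∉ interior (C : Set X))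
    (hmono : OrderPreservingOn C φ (interior (C : Set X)) (interior (C : Set X)))
    (he : e ∈ interior (C : Set X)) (hzero : φ e = 0) (hμ : 0 < μ)
    (hα : RadialBound C φ e (Real.log μ) α) (hα0 : 0 ≤ α)
    (hx : x ∈ closedInterval C (μ⁻¹ • e) (μ • e)) :
    existenceTime φ (interior (C : Set X)) x = ⊤ := by
  have hL := hφ.locallyLipschitzOn isOpen_interior
  have hp : μ⁻¹ • e ∈ interior (C : Set X) := smul_mem_interior (inv_pos.2 hμ) he
  obtain ⟨τ, hτ, hsol⟩ := hC.exists_forall_isSolution hφ hp (μ • e)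
  refine existenceTime_eq_top_of_forall_mem hτ hsol hx fun b γ hγ t ht htb => ?_
  have hdx := (mem_closedInterval_iff_dT_le h0 (closedInterval_subset_interior hp hx) he hμ).1 hx
  exact (mem_closedInterval_iff_dT_le h0 (hγ.mem t ht htb) he hμ).2
    (hα.dT_le_of_nonneg h0 hmono hL he hzero hα0 hγ ht htb hdx).2

end NormalCone

end Thompson

open Thompson in
theorem mainTheorem5_general {X : Type*} [NormedAddCommGroup X] [NormedSpace ℝ X]
    [CompleteSpace X] (C : ProperCone ℝ X) (hC : (0 : X) ∉ interior (C : Set X))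
    (φ : X → X) (hφ : LipschitzOnBoundedConvex φ (interior (C : Set X)))
    (hmono : OrderPreservingOn C φ (interior (C : Set X)) (interior (C : Set X)))
    (xbar : X) (hxbar : xbar ∈ interior (C : Set X)) (hzero : φ xbar = 0)
    (μ : ℝ) (hμ : 1 < μ) :
    ∃ α : ℝ,
      IsGLB (radialRatios C φ xbar μ) α ∧
      IsGreatest {β : ℝ | ContractsAtRate C φ xbar
        (openInterval C (μ⁻¹ • xbar) (μ • xbar)) β} α ∧
      (0 ≤ α → ∀ x ∈ closedInterval C (μ⁻¹ • xbar) (μ • xbar),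
        (∀ t : ℝ, 0 ≤ t → (t : EReal) < existenceTime φ (interior (C : Set X)) x →
          dT C (flow φ (interior (C : Set X)) t x) xbar ≤
            Real.exp (-α * t) * dT C x xbar) ∧
        (IsNormal C →
          existenceTime φ (interior (C : Set X)) x = ⊤)) := by
  have hμ0 : 0 < μ := one_pos.trans hμ
  have hL := hφ.locallyLipschitzOn isOpen_interior
  have hrate : ∀ β, RadialBound C φ xbar (Real.log μ) β ↔
      β ∈ lowerBounds (radialRatios C φ xbar μ) := fun β =>
    radialBound_log_iff_mem_lowerBounds hC hL.continuousOn hxbar hμ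
  have hcontracts : {β | ContractsAtRate C φ xbar (openInterval C (μ⁻¹ • xbar) (μ • xbar)) β} =
      lowerBounds (radialRatios C φ xbar μ) := Set.ext fun β =>
    (contractsAtRate_iff_radialBound hC hmono hL hxbar hzero hμ).trans (hrate β)
  obtain ⟨β, hβ⟩ := exists_radialBound hL hxbar hzero (Real.log_pos hμ).le
  obtain ⟨α, hα⟩ := Real.exists_isGLB (radialRatios_nonempty hμ) ⟨β, (hrate β).1 hβ⟩
  have hbound : RadialBound C φ xbar (Real.log μ) α := (hrate α).2 hα.1
  refine ⟨α, hα, hcontracts ▸ hα, fun hα0 x hx => ⟨fun t ht hlt => ?_, fun hnormal => ?_⟩⟩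
  · have hxC := closedInterval_subset_interior (smul_mem_interior (inv_pos.2 hμ0) hxbar) hx
    exact hbound.dT_flow_le_of_nonneg hC hmono hL hxbar hzero hα0
      ((mem_closedInterval_iff_dT_le hC hxC hxbar hμ0).1 hx) ht hlt
  · exact hnormal.existenceTime_eq_top hφ hC hmono hxbar hzero hμ0 hbound hα0 hx

theorem mainTheorem5 {X : Type*} [NormedAddCommGroup X] [NormedSpace ℝ X] [CompleteSpace X]
    [Nontrivial X] (C : ProperCone ℝ X) (hC : Thompson.IsPointed C)
    (φ : X → X) (hφ : Thompson.IsAdmissible φ (interior (C : Set X)))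
    (hmono : Thompson.OrderPreservingOn C φ (interior (C : Set X)) (interior (C : Set X)))
    (xbar : X) (hxbar : xbar ∈ interior (C : Set X)) (hzero : φ xbar = 0)
    (μ : ℝ) (hμ : 1 < μ) :
    ∃ α : ℝ,
      IsGLB {r : ℝ | ∃ l : ℝ, μ⁻¹ < l ∧ l < μ ∧ l ≠ 1 ∧
        r = Thompson.lowerRatio C (-(l * Real.log l)⁻¹ • φ (l • xbar)) xbar} α ∧
      IsGreatest {β : ℝ | ∀ x ∈ Thompson.openInterval C (μ⁻¹ • xbar) (μ • xbar),
        ∀ t : ℝ, 0 ≤ t →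
          (t : EReal) < Thompson.exitTime φ (interior (C : Set X))
            (Thompson.openInterval C (μ⁻¹ • xbar) (μ • xbar)) x →
          Thompson.dT C (Thompson.flow φ (interior (C : Set X)) t x) xbar ≤
            Real.exp (-β * t) * Thompson.dT C x xbar} α ∧
      (0 ≤ α → ∀ x ∈ Thompson.closedInterval C (μ⁻¹ • xbar) (μ • xbar),
        (∀ t : ℝ, 0 ≤ t → (t : EReal) < Thompson.existenceTime φ (interior (C : Set X)) x →
          Thompson.dT C (Thompson.flow φ (interior (C : Set X)) t x) xbar ≤
            Real.exp (-α * t) * Thompson.dT C x xbar) ∧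
        (Thompson.IsNormal C →
          Thompson.existenceTime φ (interior (C : Set X)) x = ⊤)) :=
  mainTheorem5_general C hC.zero_notMem_interior φ hφ.lipschitzOnBoundedConvex hmono xbar hxbar
    hzero μ hμ
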